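/- **Theorem 3.4.** Let $G$ be a finite signed graph (loops and parallel edges allowed), given as a bidirected graph with incidence set $I$ and orientation $\sigma\colon I\to\{\pm1\}$: each edge has exactly two incidences $i\neq j$, and its sign is $-\sigma(i)\sigma(j)$. Let $u_1,u_2,w_1,w_2\in V$. A *reduced contributor* $c$ for $(u_1u_2,w_1w_2)$ assigns to each vertex $v\notin\{u_1,u_2\}$ a directed path of length one in $G$, consisting of a tail incidence at $v$ and a head incidence on the same edge, such that these paths together with the (removed) maps $u_1\mapsto w_1$, $u_2\mapsto w_2$, which need not exist in $G$, have exactly one tail and exactly one head at each vertex (so there is none if $u_1=u_2$ or $w_1=w_2$). A path whose head incidence equals its tail incidence is a *backstep*; any other path is an *adjacency*, with the sign of its edge. The sign of a component of $c$ is the product of the signs of its adjacencies (so a component without adjacencies is positive). A *circle* of $c$ is a component that is a closed directed walk along adjacencies (a single backstep is not a circle). Let $$\mathrm{sgn}_D(c)=(-1)^{ec(\check c)+nc(c)+bs(c)},$$ where $ec(\check c)$ is the number of even cycles of the permutation of $V$ obtained from $c$ by restoring $u_1\mapsto w_1$ and $u_2\mapsto w_2$, $nc(c)$ is the number of negative components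 of $c$, and $bs(c)$ is the number of backsteps of $c$. The *D-contributor-transpedance* is $$[u_1u_2,w_1w_2]_D=\sum_{c}\mathrm{sgn}_D(c),$$ the sum over all reduced contributors for $(u_1u_2,w_1w_2)$. Two reduced contributors are in the same *reduced activation class* if their tail incidences agree at every $v\notin\{u_1,u_2\}$; each class is ordered by inclusion of the sets of circles. Let $\mathcal M^-$ be the set of those maximal elements of reduced activation classes that contain no positive circle. Then each reduced activation class has exactly one maximal element, this element lies in $\mathcal M^-$ if and only if no element of the class contains a positive circle, and $$[u_1u_2,w_1w_2]_D=\sum_{m\in\mathcal M^-}\mathrm{sgn}_D(m)\cdot 2^{\eta(m)},$$ where $\eta(m)$ is the number of negative circles of $m$. Moreover, if some element of a reduced activation class $\mathcal A$ contains a positive circle, then $\sum_{c\in\mathcal A}\mathrm{sgn}_D(c)=0$. -/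

import Mathlib

/-- A bidirected graph, that is, an oriented incidence hypergraph all of whose edges are 2-edges.
`V`, `E`, `I` are the sets of vertices, edges and incidences, `vert : I → V` and `edge : I → E` are
the two incidence maps, and `orient : I → {+1, -1}` is the orientation. Loops (both incidences of
an edge at one vertex) and parallel edges are allowed. The signed graph that it carries gives an
edge with incidences `i ≠ j` the sign `-(orient i * orient j)`; every signed graph arises so. -/
structure BidirectedGraph (V E I : Type*) where
  vert : I → V
  edge : I → E
  orient : I → ℤˣ
  two_edge : ∀ e : E, Nat.card {i : I // edge i = e} = 2

namespace BidirectedGraph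

variable {V E I : Type*}

/-- The non-zero reduced contributors of the zero-loading of `G` for the vectors `u`, `w`.
A contributor sends, for each vertex `v`, a directed path of length one into the graph: its tail
incidence is at `v`, its head incidence lies on the same edge (head incidence equal to tail
incidence is a backstep), and the heads cover the vertex set. Here the paths `u i ↦ w i` have been
removed, so that only the tails `v` outside `u` carry a path, which has to lie in `G`; the removed
paths need not exist in `G`, but together with them there is exactly one tail and exactly one head
at each vertex. -/
@[ext]
structure ReducedContributor (G : BidirectedGraph V E I) {k : ℕ} (u w : Fin k → V) where
  tail : {v : V // v ∉ Set.range u} → I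
  head : {v : V // v ∉ Set.range u} → I
  vert_tail : ∀ v, G.vert (tail v) = v
  edge_tail_eq : ∀ v, G.edge (tail v) = G.edge (head v)
  one_tail : Function.Bijective
    (Sum.elim u (fun v => (v : V)) : Fin k ⊕ {v : V // v ∉ Set.range u} → V)
  one_head : Function.Bijective
    (Sum.elim w (fun v => G.vert (head v)) : Fin k ⊕ {v : V // v ∉ Set.range u} → V)

namespace ReducedContributor

variable {G : BidirectedGraph V E I} {k : ℕ} {u w : Fin k → V}

instance [Finite V] [Finite I] : Finite (ReducedContributor G u w) := by
  refine Finite.of_injective (fun c : ReducedContributor G u w => (c.tail, c.head)) ?_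
  intro c c' h
  exact ReducedContributor.ext (congrArg Prod.fst h) (congrArg Prod.snd h)

noncomputable instance [Fintype V] [Fintype I] : Fintype (ReducedContributor G u w) :=
  Fintype.ofFinite _

/-- The path at `v` is a backstep. -/
def IsBackstep (c : ReducedContributor G u w) (v : {v : V // v ∉ Set.range u}) : Prop :=
  c.tail v = c.head v

/-- The permutation of `V` underlying the unreduced contributor: it maps `u i` to `w i`, and every
other vertex to the vertex at the head of its path. -/
noncomputable def unreducedPerm (c : ReducedContributor G u w) : Equiv.Perm V :=
  (Equiv.ofBijective _ c.one_tail).symm.trans (Equiv.ofBijective _ c.one_head)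

/-- `c` has a path from `v` to `v'`. -/
def Step (c : ReducedContributor G u w) (v v' : V) : Prop :=
  ∃ h : v ∉ Set.range u, G.vert (c.head ⟨v, h⟩) = v'

open Classical in
/-- The vertex set of the component of `c` that contains `v`. -/
noncomputable def component [Fintype V] (c : ReducedContributor G u w) (v : V) : Finset V :=
  Finset.univ.filter (fun v' => Relation.EqvGen c.Step v v')

open Classical in
/-- The components of `c`, given by their vertex sets: circles, single backsteps, and the open
directed walks from an entry of `w` to an entry of `u` (left by removing `u i ↦ w i`). -/
noncomputable def components [Fintype V] (c : ReducedContributor G u w) : Finset (Finset V) :=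
  Finset.univ.image c.component

open Classical in
/-- The sign of the adjacency traversed by the path at `v`; backsteps, which are no adjacencies, do
not contribute. -/
noncomputable def pathSign (c : ReducedContributor G u w) (v : {v : V // v ∉ Set.range u}) : ℤˣ :=
  if c.IsBackstep v then 1 else -(G.orient (c.tail v) * G.orient (c.head v))

open Classical in
/-- The sign of a part of `c`: the product of the signs of its adjacencies. -/
noncomputable def partSign [Fintype V] (c : ReducedContributor G u w) (K : Finset V) : ℤˣ :=
  ∏ v : {v : V // v ∉ Set.range u}, if (v : V) ∈ K then c.pathSign v else 1

/-- A circle: a component that is a closed walk along adjacencies, i.e. each of its vertices is the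
tail of a path of `c` that is not a backstep. -/
def IsCircle [Fintype V] (c : ReducedContributor G u w) (K : Finset V) : Prop :=
  K ∈ c.components ∧ ∀ v ∈ K, ∃ h : v ∉ Set.range u, ¬ c.IsBackstep ⟨v, h⟩

/-- The graph image of a part of `c`: the set of its (tail incidence, head incidence) pairs. -/
def image (c : ReducedContributor G u w) (K : Finset V) : Set (I × I) :=
  {p | ∃ v : {v : V // v ∉ Set.range u}, (v : V) ∈ K ∧ p = (c.tail v, c.head v)}

/-- The set of circles of `c`, as subobjects of `G`. -/
def circles [Fintype V] (c : ReducedContributor G u w) : Set (Set (I × I)) :=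
  {C | ∃ K, c.IsCircle K ∧ C = c.image K}

/-- `c` contains a positive circle. -/
def HasPositiveCircle [Fintype V] (c : ReducedContributor G u w) : Prop :=
  ∃ K, c.IsCircle K ∧ c.partSign K = 1

open Classical in
/-- `η(c)`, the number of negative circles of `c`. -/
noncomputable def numNegCircles [Fintype V] (c : ReducedContributor G u w) : ℕ :=
  (c.components.filter (fun K => c.IsCircle K ∧ c.partSign K = -1)).card

open Classical in
/-- `ec`, the number of even cycles of the unreduced contributor. -/
noncomputable def evenCycles [Fintype V] (c : ReducedContributor G u w) : ℕ :=
  (c.unreducedPerm.cycleType.filter (fun n => Even n)).card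

open Classical in
/-- `nc`, the number of negative components of `c`. -/
noncomputable def negComponents [Fintype V] (c : ReducedContributor G u w) : ℕ :=
  (c.components.filter (fun K => c.partSign K = -1)).card

open Classical in
/-- `bs`, the number of backsteps of `c`. -/
noncomputable def backsteps [Fintype V] (c : ReducedContributor G u w) : ℕ :=
  (Finset.univ.filter (fun v => c.IsBackstep v)).card

/-- The determinant-sign of a reduced contributor. -/
noncomputable def sgnD [Fintype V] (c : ReducedContributor G u w) : ℤ :=
  (-1) ^ (c.evenCycles + c.negComponents + c.backsteps)

/-- Tail-equivalence: the tail incidences agree. -/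
def TailEquiv (c c' : ReducedContributor G u w) : Prop :=
  c.tail = c'.tail

/-- The order on activation classes: tail-equivalent contributors are ordered by inclusion of their
sets of circles. -/
instance [Fintype V] : Preorder (ReducedContributor G u w) where
  le c c' := c.TailEquiv c' ∧ c.circles ⊆ c'.circles
  le_refl c := ⟨rfl, subset_rfl⟩
  le_trans _ _ _ h h' := ⟨h.1.trans h'.1, h.2.trans h'.2⟩

open Classical in
/-- The reduced activation class of `c`. -/
noncomputable def activationClass [Fintype V] [Fintype I] (c : ReducedContributor G u w) :
    Finset (ReducedContributor G u w) :=
  Finset.univ.filter (fun c' => c.TailEquiv c')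

end ReducedContributor

variable [Fintype V] [Fintype I] (G : BidirectedGraph V E I) {k : ℕ} (u w : Fin k → V)

open Classical in
/-- The set of all (nonempty) reduced activation classes. -/
noncomputable def activationClasses : Finset (Finset (ReducedContributor G u w)) :=
  Finset.univ.image ReducedContributor.activationClass

open Classical in
/-- The reduced activation classes none of whose elements contains a positive circle. -/
noncomputable def negActivationClasses : Finset (Finset (ReducedContributor G u w)) :=
  (activationClasses G u w).filter (fun A => ∀ c ∈ A, ¬ c.HasPositiveCircle)

open Classical in
/-- The maximal elements of the reduced activation classes. -/
noncomputable def maximalElements : Finset (ReducedContributor G u w) :=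
  Finset.univ.filter (fun m => ∃ A ∈ activationClasses G u w, Maximal (fun c => c ∈ A) m)

open Classical in
/-- The maximal elements that are free of positive circles. -/
noncomputable def negMaximalElements : Finset (ReducedContributor G u w) :=
  (maximalElements G u w).filter (fun m => ¬ m.HasPositiveCircle)

/-- The D-contributor-transpedance `[u₁u₂, w₁w₂]_D`. -/
noncomputable def dTranspedance (u₁ u₂ w₁ w₂ : V) : ℤ :=
  ∑ c : ReducedContributor G ![u₁, u₂] ![w₁, w₂], c.sgnD

end BidirectedGraph

/-! Fix the tails. As an edge has only two incidences, each path is either a backstep or the one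
possible adjacency, so a contributor is determined by its set of active vertices, those carrying an
adjacency. For tail-equivalent `c` and `c'`, the vertices active only in `c` form a union of orbits
of the permutation of `c`: `c'` fixes them, and injectivity excludes any orbit that enters or leaves
this set. These orbits are circles of `c`, and grafting them onto `c'` gives a join
(`exists_active_eq_union`). By finiteness the class has an element `m` whose active set contains all
others.

Every element of the class arises from `m` by turning a set of circles of `m` into backsteps, and
every set of circles occurs, so the class is a Boolean lattice on the circles of `m`. By `sgnD_eq`
the sign is a permutation sign times a product over the paths. Deactivating a circle `K` multiplies
the permutation sign by `(-1)^(|K|+1)` and replaces the sign of `K` by `(-1)^|K|`, a total factor of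
minus the sign of `K`. The class therefore sums to the sign of `m` times the product of `1 -
partSign K` over the circles (`IsTop.sum_sgnD`): a positive circle gives a factor 0, a negative one
a factor 2. -/

/-! ### Signs of permutations -/

open Classical in
/-- Restricting a permutation to a union of its orbits changes the sign by the expected product. -/
theorem exists_perm_eqOn_orbits {α : Type*} [Fintype α] (f : Equiv.Perm α)
    (T : Finset (Finset α)) (hT : ∀ K ∈ T, ∃ x, K = Finset.univ.filter (f.SameCycle x)) :
    ∃ g : Equiv.Perm α, (∀ x, g x = if ∃ K ∈ T, x ∈ K then f x else x) ∧
      Equiv.Perm.sign g = ∏ K ∈ T, (-1) ^ (K.card + 1) := by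
  induction T using Finset.induction_on with
  | empty => exact ⟨1, by simp, by simp⟩
  | insert K T hK ih =>
    obtain ⟨g, hg, hs⟩ := ih fun L hL => hT L (Finset.mem_insert_of_mem hL)
    obtain ⟨x, hx⟩ := hT K (Finset.mem_insert_self _ _)
    have hdisj : ∀ y ∈ K, ¬ ∃ L ∈ T, y ∈ L := by
      rintro y hy ⟨L, hL, hyL⟩
      obtain ⟨z, hz⟩ := hT L (Finset.mem_insert_of_mem hL)
      apply hK
      have hxy : f.SameCycle x y := by simpa [hx] using hy
      have hzy : f.SameCycle z y := by simpa [hz] using hyL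
      have : K = L := by
        ext a
        simp only [hx, hz, Finset.mem_filter, Finset.mem_univ, true_and]
        exact ⟨fun h => hzy.trans (hxy.symm.trans h), fun h => hxy.trans (hzy.symm.trans h)⟩
      exact this ▸ hL
    have hmem : ∀ y, y ∈ K ↔ f.SameCycle x y := by simp [hx]
    refine ⟨g * f.cycleOf x, fun y => ?_, ?_⟩
    · rw [Equiv.Perm.mul_apply, Equiv.Perm.cycleOf_apply]
      by_cases hy : f.SameCycle x y
      · have h1 : f y ∈ K := (hmem _).2 (Equiv.Perm.sameCycle_apply_right.2 hy)
        rw [if_pos hy, hg, if_neg (hdisj _ h1),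
          if_pos ⟨K, Finset.mem_insert_self _ _, (hmem _).2 hy⟩]
      · have h1 : y ∉ K := fun h => hy ((hmem _).1 h)
        rw [if_neg hy, hg]
        simp [h1]
    · rw [map_mul, hs, Finset.prod_insert hK, mul_comm]
      congr 1
      -- A one-point orbit is allowed, since an adjacency along a loop fixes its vertex; then
      -- `f.cycleOf x = 1` and the exponent is 2.
      by_cases hfx : f x = x
      · have hKc : K = {x} := by
          ext y
          rw [hmem, Finset.mem_singleton]
          constructor
          · rintro ⟨n, hn⟩
            rw [← hn, Equiv.Perm.zpow_apply_eq_self_of_apply_eq_self hfx]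
          · rintro rfl
            exact Equiv.Perm.SameCycle.refl _ _
        rw [(Equiv.Perm.cycleOf_eq_one_iff f).2 hfx, hKc]
        simp
      · rw [(Equiv.Perm.isCycle_cycleOf f hfx).sign]
        have : (f.cycleOf x).support = K := by
          ext y
          rw [hmem, Equiv.Perm.mem_support_cycleOf_iff' hfx]
        rw [this, pow_succ]
        simp

/-- Applied to a cycle type, this turns the count of even cycles into the permutation sign. Fixed
points are absent from the cycle type, harmlessly, because they are odd cycles. -/
theorem Multiset.neg_one_pow_card_filter_even (s : Multiset ℕ) :
    (-1 : ℤˣ) ^ (s.filter (fun n => Even n)).card = (-1) ^ (s.sum + s.card) := by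
  induction s using Multiset.induction_on with
  | empty => simp
  | cons a s ih =>
    rw [Multiset.sum_cons, Multiset.card_cons,
      show a + s.sum + (s.card + 1) = (a + 1) + (s.sum + s.card) by ring, pow_add, ← ih]
    by_cases h : Even a
    · rw [Multiset.filter_cons_of_pos _ h, Multiset.card_cons, pow_succ, h.add_one.neg_one_pow,
        mul_comm]
    · rw [Multiset.filter_cons_of_neg _ h, (Nat.not_even_iff_odd.1 h).add_one.neg_one_pow, one_mul]

/-! ### Contributors with prescribed tails -/

namespace BidirectedGraph.ReducedContributor

variable {V E I : Type*} {G : BidirectedGraph V E I} {k : ℕ} {u w : Fin k → V}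

@[simp]
theorem unreducedPerm_apply_u (c : ReducedContributor G u w) (i : Fin k) :
    c.unreducedPerm (u i) = w i := by
  have h : (Equiv.ofBijective _ c.one_tail).symm (u i) = Sum.inl i := by
    rw [Equiv.symm_apply_eq]; rfl
  simp [unreducedPerm, h]

theorem unreducedPerm_apply (c : ReducedContributor G u w) (v : {v : V // v ∉ Set.range u}) :
    c.unreducedPerm v = G.vert (c.head v) := by
  have h : (Equiv.ofBijective _ c.one_tail).symm (v : V) = Sum.inr v := by
    rw [Equiv.symm_apply_eq]; rfl
  simp [unreducedPerm, h]

/-- A contributor with the tails of `c` can be prescribed by its heads and its permutation. -/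
theorem exists_of_perm (c : ReducedContributor G u w) (h : {v : V // v ∉ Set.range u} → I)
    (he : ∀ v, G.edge (c.tail v) = G.edge (h v)) (p : Equiv.Perm V) (hu : ∀ i, p (u i) = w i)
    (hp : ∀ v : {v : V // v ∉ Set.range u}, p v = G.vert (h v)) :
    ∃ c' : ReducedContributor G u w, c'.tail = c.tail ∧ c'.head = h := by
  refine ⟨⟨c.tail, h, c.vert_tail, he, c.one_tail, ?_⟩, rfl, rfl⟩
  have : (Sum.elim w (fun v => G.vert (h v)) : Fin k ⊕ {v : V // v ∉ Set.range u} → V) =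
      p ∘ (Sum.elim u (fun v => (v : V)) : Fin k ⊕ {v : V // v ∉ Set.range u} → V) := by
    ext (i | v) <;> simp [hu, hp]
  rw [this]
  exact p.bijective.comp c.one_tail

/-- With two incidences on each edge, the only head other than the tail is the second incidence. -/
theorem head_eq_head {c c' : ReducedContributor G u w} (h : c.tail = c'.tail)
    {v : {v : V // v ∉ Set.range u}} (hc : ¬ c.IsBackstep v) (hc' : ¬ c'.IsBackstep v) :
    c.head v = c'.head v := by
  by_contra hne
  have h2 := G.two_edge (G.edge (c.tail v))
  obtain ⟨x, y, hxy, hall⟩ := Nat.card_eq_two_iff.1 h2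
  have hm : ∀ z : {i : I // G.edge i = G.edge (c.tail v)}, z = x ∨ z = y := by
    intro z
    have : z ∈ ({x, y} : Set _) := hall ▸ Set.mem_univ z
    simpa using this
  have a1 := hm ⟨c.tail v, rfl⟩
  have a2 := hm ⟨c.head v, (c.edge_tail_eq v).symm⟩
  have a3 := hm ⟨c'.head v, by rw [h]; exact (c'.edge_tail_eq v).symm⟩
  unfold IsBackstep at hc hc'
  rw [← h] at hc'
  grind

theorem orient_mul_self (G : BidirectedGraph V E I) (i : I) : G.orient i * G.orient i = 1 :=
  Int.units_mul_self _

/-! ### Active vertices and joins -/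

section Fintype

variable [Fintype V]

open Classical

/-- The vertices at which `c` has an adjacency. -/
noncomputable def active (c : ReducedContributor G u w) : Finset V :=
  Finset.univ.filter fun v => ∃ h : v ∉ Set.range u, ¬ c.IsBackstep ⟨v, h⟩

theorem mem_active {c : ReducedContributor G u w} {v : V} :
    v ∈ c.active ↔ ∃ h : v ∉ Set.range u, ¬ c.IsBackstep ⟨v, h⟩ := by
  simp [active]

theorem coe_mem_active {c : ReducedContributor G u w} {v : {v : V // v ∉ Set.range u}} :
    (v : V) ∈ c.active ↔ ¬ c.IsBackstep v := by
  rw [mem_active]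
  exact ⟨fun ⟨_, h⟩ => h, fun h => ⟨v.2, h⟩⟩

theorem head_eq_of_not_mem_active {c : ReducedContributor G u w}
    {v : {v : V // v ∉ Set.range u}} (h : (v : V) ∉ c.active) : c.head v = c.tail v := by
  rw [coe_mem_active, not_not] at h
  exact h.symm

theorem unreducedPerm_eq_self {c : ReducedContributor G u w} {v : V} (hu : v ∉ Set.range u)
    (h : v ∉ c.active) : c.unreducedPerm v = v := by
  rw [c.unreducedPerm_apply ⟨v, hu⟩, head_eq_of_not_mem_active (v := ⟨v, hu⟩) h, c.vert_tail]

theorem unreducedPerm_eq_of_active {c c' : ReducedContributor G u w} (h : c.tail = c'.tail)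
    {v : V} (hc : v ∈ c.active) (hc' : v ∈ c'.active) :
    c.unreducedPerm v = c'.unreducedPerm v := by
  obtain ⟨hu, h1⟩ := mem_active.1 hc
  obtain ⟨_, h2⟩ := mem_active.1 hc'
  rw [c.unreducedPerm_apply ⟨v, hu⟩, c'.unreducedPerm_apply ⟨v, hu⟩, head_eq_head h h1 h2]

theorem eq_of_active_eq {c c' : ReducedContributor G u w} (h : c.tail = c'.tail)
    (ha : c.active = c'.active) : c = c' := by
  refine ReducedContributor.ext h (funext fun v => ?_)
  by_cases hv : (v : V) ∈ c.active
  · exact head_eq_head h (coe_mem_active.1 hv) (coe_mem_active.1 (ha ▸ hv))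
  · rw [head_eq_of_not_mem_active hv, head_eq_of_not_mem_active (ha ▸ hv), h]

/-- The vertices active in `c` but not in `c'` are closed under predecessors in `c`. -/
theorem symm_apply_mem_sdiff {c c' : ReducedContributor G u w} (h : c.tail = c'.tail) {z : V}
    (hz : z ∈ c.active \ c'.active) : c.unreducedPerm.symm z ∈ c.active \ c'.active := by
  rw [Finset.mem_sdiff] at hz ⊢
  obtain ⟨y, rfl⟩ := c.unreducedPerm.surjective z
  rw [Equiv.symm_apply_apply]
  have hzu := (mem_active.1 hz.1).1
  have hfix := unreducedPerm_eq_self hzu hz.2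
  -- The predecessor `y` of `z` in `c` is compared with `z`, which `c'` fixes. An inactive `y` is
  -- either some `u i`, where both permutations agree, so that injectivity of `c'` gives `y = z`, or
  -- a fixed point of `c`, so again `y = z`. Both are impossible.
  have hy : y ∈ c.active := by
    by_contra hy
    by_cases hyu : y ∈ Set.range u
    · obtain ⟨i, rfl⟩ := hyu
      rw [unreducedPerm_apply_u, ← unreducedPerm_apply_u c' i] at hfix
      have := c'.unreducedPerm.injective hfix
      rw [unreducedPerm_apply_u, ← unreducedPerm_apply_u c' i, this] at hzu
      exact hzu ⟨i, rfl⟩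
    · rw [unreducedPerm_eq_self hyu hy] at hz
      exact hy hz.1
  refine ⟨hy, fun hy' => hz.2 ?_⟩
  rw [unreducedPerm_eq_of_active h hy hy'] at hfix
  have := c'.unreducedPerm.injective hfix
  rw [unreducedPerm_eq_of_active h hy hy', this]
  exact hy'

/-- On a finite set, closure under an injective predecessor map is invariance, so closure under
successors follows. -/
theorem apply_mem_sdiff_iff {c c' : ReducedContributor G u w} (h : c.tail = c'.tail) {z : V} :
    c.unreducedPerm z ∈ c.active \ c'.active ↔ z ∈ c.active \ c'.active := by
  have hm : (c.active \ c'.active).map c.unreducedPerm.symm.toEmbedding = c.active \ c'.active := by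
    refine Finset.eq_of_subset_of_card_le (fun y hy => ?_) (by simp)
    obtain ⟨z, hz, rfl⟩ := Finset.mem_map.1 hy
    exact symm_apply_mem_sdiff h hz
  constructor
  · intro hz
    simpa using symm_apply_mem_sdiff h hz
  · intro hz
    rw [← hm, Finset.mem_map] at hz
    obtain ⟨y, hy, rfl⟩ := hz
    simpa using hy

theorem mem_sdiff_of_sameCycle {c c' : ReducedContributor G u w} (h : c.tail = c'.tail) {x y : V}
    (hx : x ∈ c.active \ c'.active) (hxy : c.unreducedPerm.SameCycle x y) :
    y ∈ c.active \ c'.active := by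
  obtain ⟨n, -, -, rfl⟩ := hxy.exists_pow_eq
  induction n with
  | zero => simpa using hx
  | succ n ih =>
    rw [pow_succ', Equiv.Perm.mul_apply, apply_mem_sdiff_iff h]
    exact ih ⟨n, by simp⟩

/-- Two tail-equivalent contributors have a join. -/
theorem exists_active_eq_union (c c' : ReducedContributor G u w) (h : c.tail = c'.tail) :
    ∃ d : ReducedContributor G u w, d.tail = c.tail ∧ d.active = c.active ∪ c'.active := by
  set r : Equiv.Perm V := Equiv.Perm.ofSubtype
    (c.unreducedPerm.subtypePerm (p := fun v => v ∈ c.active \ c'.active)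
      fun v => apply_mem_sdiff_iff h) with hr
  have hr1 : ∀ v ∈ c.active \ c'.active, r v = c.unreducedPerm v := fun v hv => by
    rw [hr, Equiv.Perm.ofSubtype_apply_of_mem _ hv]; rfl
  have hr2 : ∀ v, v ∉ c.active \ c'.active → r v = v := fun v hv => by
    rw [hr, Equiv.Perm.ofSubtype_apply_of_not_mem _ hv]
  obtain ⟨d, hd, hdh⟩ := c.exists_of_perm
    (fun v => if (v : V) ∈ c.active then c.head v else c'.head v)
    (fun v => by
      split_ifs
      · exact c.edge_tail_eq v
      · rw [h]; exact c'.edge_tail_eq v)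
    -- On the difference set, `r` moves along `c` and stays in the set, which `c'` fixes pointwise;
    -- elsewhere `r` is trivial. The product thus follows `c` on the difference set and `c'` outside
    -- it.
    (c'.unreducedPerm * r)
    (fun i => by
      have : u i ∉ c.active \ c'.active := fun hi =>
        (mem_active.1 (Finset.mem_sdiff.1 hi).1).1 ⟨i, rfl⟩
      rw [Equiv.Perm.mul_apply, hr2 _ this, unreducedPerm_apply_u])
    (fun v => by
      rw [Equiv.Perm.mul_apply]
      by_cases h1 : (v : V) ∈ c.active
      · rw [if_pos h1, ← unreducedPerm_apply]
        by_cases h2 : (v : V) ∈ c'.active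
        · rw [hr2 _ (by simp [h2]), unreducedPerm_eq_of_active h h1 h2]
        · have h3 : (v : V) ∈ c.active \ c'.active := Finset.mem_sdiff.2 ⟨h1, h2⟩
          have h4 := Finset.mem_sdiff.1 ((apply_mem_sdiff_iff h).2 h3)
          rw [hr1 _ h3, unreducedPerm_eq_self (mem_active.1 h4.1).1 h4.2]
      · rw [if_neg h1, hr2 _ (by simp [h1]), unreducedPerm_apply])
  refine ⟨d, hd, ?_⟩
  ext v
  rw [Finset.mem_union]
  by_cases hv : v ∈ Set.range u
  · simp [mem_active, hv]
  · lift v to {v : V // v ∉ Set.range u} using hv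
    by_cases h1 : (v : V) ∈ c.active
    · simp only [h1, true_or, iff_true]
      rw [coe_mem_active] at h1 ⊢
      rw [IsBackstep, hd, hdh]
      simp only [coe_mem_active, h1, not_false_eq_true, if_true]
      exact h1
    · simp only [h1, false_or]
      rw [coe_mem_active, coe_mem_active, IsBackstep, IsBackstep, hd, hdh, h]
      simp [h1]

/-! ### A multiplicative formula for the sign -/

theorem prod_partSign_components (c : ReducedContributor G u w) :
    ∏ K ∈ c.components, c.partSign K = ∏ v, c.pathSign v := by
  unfold partSign
  rw [Finset.prod_comm]
  refine Finset.prod_congr rfl fun v _ => ?_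
  rw [Finset.prod_eq_single (c.component v)]
  · rw [if_pos]
    simp only [component, Finset.mem_filter, Finset.mem_univ, true_and]
    exact Relation.EqvGen.refl _
  · intro K hK hne
    rw [if_neg]
    intro hv
    obtain ⟨x, -, rfl⟩ := Finset.mem_image.1 hK
    apply hne
    simp only [component, Finset.mem_filter, Finset.mem_univ, true_and] at hv
    ext y
    simp only [component, Finset.mem_filter, Finset.mem_univ, true_and]
    exact ⟨fun h => (hv.symm _ _).trans _ _ _ h, fun h => hv.trans _ _ _ h⟩
  · intro h
    exact absurd (Finset.mem_image_of_mem _ (Finset.mem_univ _)) h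

/-- This form is local in the paths. A backstep has equal incidences, so its factor is `-1` and
accounts for the backstep count; an adjacency contributes the sign of its edge. -/
theorem sgnD_eq (c : ReducedContributor G u w) :
    c.sgnD = ((Equiv.Perm.sign c.unreducedPerm *
      ∏ v, -(G.orient (c.tail v) * G.orient (c.head v)) : ℤˣ) : ℤ) := by
  have h1 : (-1 : ℤˣ) ^ c.evenCycles = Equiv.Perm.sign c.unreducedPerm := by
    rw [Equiv.Perm.sign_of_cycleType, ← Multiset.neg_one_pow_card_filter_even, evenCycles]
  have h2 : (-1 : ℤˣ) ^ c.negComponents = ∏ v, c.pathSign v := by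
    rw [← prod_partSign_components, negComponents, ← Finset.prod_const, Finset.prod_filter]
    refine Finset.prod_congr rfl fun K _ => ?_
    rcases Int.units_eq_one_or (c.partSign K) with h | h <;> simp [h]
  have h3 : (-1 : ℤˣ) ^ c.backsteps = ∏ v, if c.IsBackstep v then (-1 : ℤˣ) else 1 := by
    rw [backsteps, ← Finset.prod_const, Finset.prod_filter]
  have : c.sgnD = (((-1 : ℤˣ) ^ (c.evenCycles + c.negComponents + c.backsteps) : ℤˣ) : ℤ) := by
    rw [sgnD]; push_cast; rfl
  rw [this, pow_add, pow_add, h1, h2, h3, mul_assoc, ← Finset.prod_mul_distrib]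
  congr 2
  refine Finset.prod_congr rfl fun v _ => ?_
  unfold pathSign
  split_ifs with h
  · have : c.tail v = c.head v := h
    rw [this, orient_mul_self, one_mul]
  · rw [mul_one]

/-! ### Circles as orbits of active vertices -/

/-- An active vertex lies outside `u`, so on a set of active vertices the permutation only follows
paths of `c` and never a restored `u i ↦ w i`. Components and orbits then coincide. -/
theorem isCircle_iff {c : ReducedContributor G u w} {K : Finset V} :
    c.IsCircle K ↔
      K ⊆ c.active ∧ ∃ x, K = Finset.univ.filter (c.unreducedPerm.SameCycle x) := by
  have step : ∀ {a b}, c.Step a b → c.unreducedPerm a = b := by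
    rintro a b ⟨h, hb⟩
    rw [c.unreducedPerm_apply ⟨a, h⟩, hb]
  have eqv : ∀ {a b}, Relation.EqvGen c.Step a b → c.unreducedPerm.SameCycle a b := by
    intro a b h
    induction h with
    | rel a b h => exact ⟨1, by simpa using step h⟩
    | refl a => exact Equiv.Perm.SameCycle.refl _ _
    | symm a b _ ih => exact ih.symm
    | trans a b d _ _ h1 h2 => exact h1.trans h2
  have conv : ∀ {x : V} {K : Finset V}, x ∈ K → K ⊆ c.active →
      (∀ y ∈ K, c.unreducedPerm y ∈ K) → ∀ {y}, c.unreducedPerm.SameCycle x y →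
      Relation.EqvGen c.Step x y ∧ y ∈ K := by
    intro x K hx hK hcl y hy
    obtain ⟨n, -, -, rfl⟩ := hy.exists_pow_eq
    clear hy
    induction n with
    | zero => exact ⟨Relation.EqvGen.refl _, hx⟩
    | succ n ih =>
      obtain ⟨ih1, ih2⟩ := ih
      rw [pow_succ', Equiv.Perm.mul_apply]
      refine ⟨ih1.trans _ _ _ (Relation.EqvGen.rel _ _ ?_), hcl _ ih2⟩
      exact ⟨(mem_active.1 (hK ih2)).1, (c.unreducedPerm_apply ⟨_, _⟩).symm⟩
  have hact : (∀ v ∈ K, ∃ h : v ∉ Set.range u, ¬ c.IsBackstep ⟨v, h⟩) ↔ K ⊆ c.active := by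
    simp only [← mem_active]; rfl
  rw [IsCircle, hact, and_comm]
  refine and_congr_right fun hK => ?_
  constructor
  · intro h
    obtain ⟨x, -, rfl⟩ := Finset.mem_image.1 h
    refine ⟨x, ?_⟩
    ext y
    have hx : x ∈ c.component x := by simpa [component] using Relation.EqvGen.refl _
    have hcl : ∀ y ∈ c.component x, c.unreducedPerm y ∈ c.component x := by
      intro y hy
      have hu := (mem_active.1 (hK hy)).1
      simp only [component, Finset.mem_filter, Finset.mem_univ, true_and] at hy ⊢
      exact hy.trans _ _ _ (Relation.EqvGen.rel _ _ ⟨hu, (c.unreducedPerm_apply ⟨_, _⟩).symm⟩)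
    constructor
    · intro hy
      simp only [component, Finset.mem_filter, Finset.mem_univ, true_and] at hy ⊢
      exact eqv hy
    · intro hy
      exact (conv hx hK hcl (by simpa using hy)).2
  · rintro ⟨x, hx⟩
    refine Finset.mem_image.2 ⟨x, Finset.mem_univ _, ?_⟩
    have hmem : ∀ y, y ∈ K ↔ c.unreducedPerm.SameCycle x y := by simp [hx]
    ext y
    rw [hmem]
    simp only [component, Finset.mem_filter, Finset.mem_univ, true_and]
    refine ⟨eqv, fun hy => (conv ((hmem x).2 (Equiv.Perm.SameCycle.refl _ _)) hK ?_ hy).1⟩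
    intro z hz
    exact (hmem _).2 (Equiv.Perm.sameCycle_apply_right.2 ((hmem _).1 hz))

theorem IsCircle.subset_active {c : ReducedContributor G u w} {K : Finset V} (h : c.IsCircle K) :
    K ⊆ c.active :=
  (isCircle_iff.1 h).1

theorem IsCircle.nonempty {c : ReducedContributor G u w} {K : Finset V} (h : c.IsCircle K) :
    K.Nonempty := by
  obtain ⟨x, rfl⟩ := (isCircle_iff.1 h).2
  exact ⟨x, by simp [Equiv.Perm.SameCycle.refl]⟩

theorem IsCircle.eq_of_mem {c : ReducedContributor G u w} {K L : Finset V} (hK : c.IsCircle K)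
    (hL : c.IsCircle L) {v : V} (hvK : v ∈ K) (hvL : v ∈ L) : K = L := by
  obtain ⟨x, rfl⟩ := (isCircle_iff.1 hK).2
  obtain ⟨y, rfl⟩ := (isCircle_iff.1 hL).2
  simp only [Finset.mem_filter, Finset.mem_univ, true_and] at hvK hvL
  ext z
  simp only [Finset.mem_filter, Finset.mem_univ, true_and]
  exact ⟨fun h => hvL.trans (hvK.symm.trans h), fun h => hvK.trans (hvL.symm.trans h)⟩

/-- A vertex active in `c` but not in a tail-equivalent `c'` lies on a circle of `c` that avoids
the active vertices of `c'`. -/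
theorem exists_isCircle_of_mem_sdiff {c c' : ReducedContributor G u w} (h : c.tail = c'.tail)
    {x : V} (hx : x ∈ c.active \ c'.active) :
    ∃ K, c.IsCircle K ∧ x ∈ K ∧ Disjoint K c'.active := by
  refine ⟨Finset.univ.filter (c.unreducedPerm.SameCycle x), isCircle_iff.2 ⟨?_, x, rfl⟩,
    by simp [Equiv.Perm.SameCycle.refl], ?_⟩
  · intro y hy
    exact (Finset.mem_sdiff.1 (mem_sdiff_of_sameCycle h hx (by simpa using hy))).1
  · rw [Finset.disjoint_left]
    intro y hy
    exact (Finset.mem_sdiff.1 (mem_sdiff_of_sameCycle h hx (by simpa using hy))).2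

/-- Where both contributors are active their heads agree, so they traverse the same circle. -/
theorem IsCircle.of_subset_active {c c' : ReducedContributor G u w} (h : c.tail = c'.tail)
    {K : Finset V} (hK : c.IsCircle K) (hK' : K ⊆ c'.active) :
    c'.IsCircle K ∧ c'.partSign K = c.partSign K ∧ c'.image K = c.image K := by
  have hKc := hK.subset_active
  have hhead : ∀ v : {v : V // v ∉ Set.range u}, (v : V) ∈ K → c'.head v = c.head v :=
    fun v hv => head_eq_head h.symm (coe_mem_active.1 (hK' hv)) (coe_mem_active.1 (hKc hv))
  refine ⟨?_, ?_, ?_⟩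
  · obtain ⟨x, hx⟩ := (isCircle_iff.1 hK).2
    refine isCircle_iff.2 ⟨hK', x, ?_⟩
    have hmem : ∀ y, y ∈ K ↔ c.unreducedPerm.SameCycle x y := by simp [hx]
    have hxK : x ∈ K := (hmem x).2 (Equiv.Perm.SameCycle.refl _ _)
    have hpow : ∀ n : ℕ, (c.unreducedPerm ^ n) x = (c'.unreducedPerm ^ n) x := by
      intro n
      induction n with
      | zero => rfl
      | succ n ih =>
        have hn : (c.unreducedPerm ^ n) x ∈ K := (hmem _).2 ⟨n, by simp⟩
        rw [pow_succ', pow_succ', Equiv.Perm.mul_apply, Equiv.Perm.mul_apply, ← ih]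
        exact unreducedPerm_eq_of_active h (hKc hn) (hK' hn)
    ext y
    rw [hmem, Finset.mem_filter]
    simp only [Finset.mem_univ, true_and]
    constructor <;> intro hy <;> obtain ⟨n, -, -, rfl⟩ := hy.exists_pow_eq
    · exact ⟨n, by simp [hpow]⟩
    · exact ⟨n, by simp [hpow]⟩
  · unfold partSign
    refine Finset.prod_congr rfl fun v _ => ?_
    split_ifs with hv
    · unfold pathSign
      rw [if_neg (coe_mem_active.1 (hK' hv)), if_neg (coe_mem_active.1 (hKc hv)), hhead v hv, h]
    · rfl
  · ext p
    constructor
    · rintro ⟨v, hv, rfl⟩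
      exact ⟨v, hv, by rw [hhead v hv, h]⟩
    · rintro ⟨v, hv, rfl⟩
      exact ⟨v, hv, by rw [hhead v hv, h]⟩

/-! ### Deactivating circles -/

/-- The circles of `c`, given by their vertex sets. -/
noncomputable def circleFinset (c : ReducedContributor G u w) : Finset (Finset V) :=
  c.components.filter c.IsCircle

theorem mem_circleFinset {c : ReducedContributor G u w} {K : Finset V} :
    K ∈ c.circleFinset ↔ c.IsCircle K := by
  simp only [circleFinset, Finset.mem_filter, and_iff_right_iff_imp]
  exact And.left

/-- Any set of circles can be deactivated. -/
theorem exists_active_eq_sdiff (m : ReducedContributor G u w) {T : Finset (Finset V)}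
    (hT : T ⊆ m.circleFinset) :
    ∃ c : ReducedContributor G u w, c.tail = m.tail ∧ c.active = m.active \ T.biUnion id := by
  obtain ⟨g, hg, -⟩ := exists_perm_eqOn_orbits m.unreducedPerm T
    fun K hK => (isCircle_iff.1 (mem_circleFinset.1 (hT hK))).2
  have hact : ∀ {v}, (∃ K ∈ T, v ∈ K) → v ∈ m.active := fun ⟨K, hK, hv⟩ =>
    (mem_circleFinset.1 (hT hK)).subset_active hv
  obtain ⟨c, hc, hch⟩ := m.exists_of_perm
    (fun v => if ∃ K ∈ T, (v : V) ∈ K then m.tail v else m.head v)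
    (fun v => by
      split_ifs
      · rfl
      · exact m.edge_tail_eq v)
    -- `g` agrees with `m` on the orbits in `T` and is trivial elsewhere, so composing with its
    -- inverse fixes exactly the chosen orbits pointwise and leaves `m` unchanged off them.
    (m.unreducedPerm * g⁻¹)
    (fun i => by
      have h1 : g (u i) = u i := by
        rw [hg, if_neg]
        intro h
        exact (mem_active.1 (hact h)).1 ⟨i, rfl⟩
      rw [Equiv.Perm.mul_apply, Equiv.Perm.inv_eq_iff_eq.2 h1.symm, unreducedPerm_apply_u])
    (fun v => by
      rw [Equiv.Perm.mul_apply]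
      split_ifs with h
      · rw [m.vert_tail]
        have hv : (v : V) = g (m.unreducedPerm.symm v) := by
          rw [hg, if_pos, Equiv.apply_symm_apply]
          obtain ⟨K, hK, hv⟩ := h
          refine ⟨K, hK, ?_⟩
          obtain ⟨x, rfl⟩ := (isCircle_iff.1 (mem_circleFinset.1 (hT hK))).2
          simp only [Finset.mem_filter, Finset.mem_univ, true_and] at hv ⊢
          rw [← Equiv.Perm.sameCycle_apply_right]
          simpa using hv
        rw [Equiv.Perm.inv_eq_iff_eq.2 hv, Equiv.apply_symm_apply]
      · have h1 : g v = v := by rw [hg, if_neg h]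
        rw [Equiv.Perm.inv_eq_iff_eq.2 h1.symm, unreducedPerm_apply])
  refine ⟨c, hc, ?_⟩
  ext v
  rw [Finset.mem_sdiff]
  by_cases hv : v ∈ Set.range u
  · simp [mem_active, hv]
  · lift v to {v : V // v ∉ Set.range u} using hv
    rw [coe_mem_active, coe_mem_active, IsBackstep, IsBackstep, hc, hch]
    simp only [Finset.mem_biUnion, id]
    by_cases h : ∃ K ∈ T, (v : V) ∈ K <;> simp only [h, if_true, if_false] <;> simp

/-! ### The top element of an activation class -/

/-- `m` has the largest set of active vertices of its activation class. -/
def IsTop (m : ReducedContributor G u w) : Prop :=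
  ∀ c : ReducedContributor G u w, c.tail = m.tail → c.active ⊆ m.active

/-- An element with the most active vertices works: its join with any other element cannot have
more, so the join adds nothing. -/
theorem exists_isTop (c : ReducedContributor G u w) :
    ∃ m : ReducedContributor G u w, m.tail = c.tail ∧ m.IsTop := by
  let P : ℕ → Prop := fun n => ∃ d : ReducedContributor G u w, d.tail = c.tail ∧ d.active.card = n
  have hP : P (Nat.findGreatest P (Fintype.card V)) :=
    Nat.findGreatest_spec (m := c.active.card) (Finset.card_le_univ _) ⟨c, rfl, rfl⟩
  obtain ⟨m, hm, hcard⟩ := hP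
  refine ⟨m, hm, fun d hd => ?_⟩
  obtain ⟨j, hj, hja⟩ := exists_active_eq_union m d hd.symm
  have hle : j.active.card ≤ m.active.card := by
    rw [hcard]
    exact Nat.le_findGreatest (Finset.card_le_univ _) ⟨j, hj.trans hm, rfl⟩
  have : m.active = j.active :=
    Finset.eq_of_subset_of_card_le (hja ▸ Finset.subset_union_left) hle
  rw [this, hja]
  exact Finset.subset_union_right

theorem IsTop.eq {m m' : ReducedContributor G u w} (hm : m.IsTop) (hm' : m'.IsTop)
    (h : m.tail = m'.tail) : m = m' :=
  eq_of_active_eq h ((hm' m h).antisymm (hm m' h.symm))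

theorem IsTop.circles_subset {m c : ReducedContributor G u w} (hm : m.IsTop)
    (h : c.tail = m.tail) : c.circles ⊆ m.circles := by
  rintro C ⟨K, hK, rfl⟩
  have := hK.of_subset_active h (hK.subset_active.trans (hm c h))
  exact ⟨K, this.1, this.2.2.symm⟩

/-- A vertex active only in `c` would lie on a circle of `c`. That circle is also one of `c'`, and
its image records the tail incidences, which identify its vertices; so the vertex would be active in
`c'`. -/
theorem active_subset_of_circles_subset {c c' : ReducedContributor G u w} (h : c.tail = c'.tail)
    (hs : c.circles ⊆ c'.circles) : c.active ⊆ c'.active := by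
  intro v hv
  by_contra hv'
  obtain ⟨K, hK, hvK, -⟩ := exists_isCircle_of_mem_sdiff h (Finset.mem_sdiff.2 ⟨hv, hv'⟩)
  obtain ⟨L, hL, hKL⟩ := hs ⟨K, hK, rfl⟩
  lift v to {v : V // v ∉ Set.range u} using (mem_active.1 hv).1
  have hmem : (c.tail v, c.head v) ∈ c'.image L := hKL ▸ ⟨v, hvK, rfl⟩
  obtain ⟨v', hv'L, heq⟩ := hmem
  have h1 : c.tail v = c.tail v' := by
    rw [h]; exact h ▸ (Prod.ext_iff.1 heq).1
  have h2 : (v : V) = v' := by rw [← c.vert_tail, h1, c.vert_tail]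
  exact hv' (hL.subset_active (h2 ▸ hv'L))

/-! ### Elements of a class as sets of deactivated circles -/

/-- The circles of `m` that are deactivated in `c`. -/
noncomputable def deactivated (m c : ReducedContributor G u w) : Finset (Finset V) :=
  m.circleFinset.filter fun K => Disjoint K c.active

theorem IsTop.active_eq {m c : ReducedContributor G u w} (hm : m.IsTop) (h : c.tail = m.tail) :
    c.active = m.active \ (m.deactivated c).biUnion id := by
  ext v
  simp only [Finset.mem_sdiff, Finset.mem_biUnion, deactivated, Finset.mem_filter,
    mem_circleFinset, id]
  constructor
  · intro hv
    refine ⟨hm c h hv, ?_⟩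
    rintro ⟨K, ⟨-, hK⟩, hvK⟩
    exact Finset.disjoint_left.1 hK hvK hv
  · rintro ⟨hv, hn⟩
    by_contra hvc
    obtain ⟨K, hK, hvK, hd⟩ := exists_isCircle_of_mem_sdiff h.symm (Finset.mem_sdiff.2 ⟨hv, hvc⟩)
    exact hn ⟨K, ⟨hK, hd⟩, hvK⟩

/-- Distinct circles are disjoint and nonempty, so the set of removed vertices determines which
circles were removed. -/
theorem deactivated_eq {m c : ReducedContributor G u w} {T : Finset (Finset V)}
    (hT : T ⊆ m.circleFinset) (hc : c.active = m.active \ T.biUnion id) :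
    m.deactivated c = T := by
  ext K
  simp only [deactivated, Finset.mem_filter, mem_circleFinset, hc]
  constructor
  · rintro ⟨hK, hd⟩
    obtain ⟨x, hx⟩ := hK.nonempty
    have := Finset.disjoint_left.1 hd hx
    simp only [Finset.mem_sdiff, hK.subset_active hx, true_and, not_not, Finset.mem_biUnion,
      id] at this
    obtain ⟨L, hL, hxL⟩ := this
    rwa [hK.eq_of_mem (mem_circleFinset.1 (hT hL)) hx hxL]
  · intro hK
    refine ⟨mem_circleFinset.1 (hT hK), Finset.disjoint_left.2 fun x hx h => ?_⟩
    exact (Finset.mem_sdiff.1 h).2 (Finset.mem_biUnion.2 ⟨K, hK, hx⟩)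

/-- Each deactivated circle `K` contributes `(-1)^(|K|+1)` through the permutation sign and
`(-1)^|K|` times its sign through the path factors; the powers combine to a single minus sign. -/
theorem IsTop.sgnD_eq_mul_prod {m c : ReducedContributor G u w} (hm : m.IsTop)
    (h : c.tail = m.tail) :
    c.sgnD = m.sgnD * ∏ K ∈ m.deactivated c, (-(m.partSign K : ℤ)) := by
  set T := m.deactivated c
  have hT : ∀ K ∈ T, m.IsCircle K := fun K hK => mem_circleFinset.1 (Finset.mem_filter.1 hK).1
  have hTd : ∀ {v K}, K ∈ T → v ∈ K → v ∉ c.active := fun hK hv =>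
    Finset.disjoint_left.1 (Finset.mem_filter.1 hK).2 hv
  have hnT : ∀ {v}, v ∈ m.active → v ∉ c.active → ∃ K ∈ T, v ∈ K := by
    intro v h1 h2
    have := hm.active_eq h
    rw [this] at h2
    simpa [h1] using h2
  have hhead : ∀ v : {v : V // v ∉ Set.range u}, (¬ ∃ K ∈ T, (v : V) ∈ K) →
      c.head v = m.head v := by
    intro v hv
    by_cases h1 : (v : V) ∈ m.active
    · have h2 : (v : V) ∈ c.active := by
        by_contra h2
        exact hv (hnT h1 h2)
      exact head_eq_head h (coe_mem_active.1 h2) (coe_mem_active.1 h1)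
    · have h2 : (v : V) ∉ c.active := fun h2 => h1 (hm c h h2)
      rw [head_eq_of_not_mem_active h1, head_eq_of_not_mem_active h2, h]
  obtain ⟨g, hg, hs⟩ := exists_perm_eqOn_orbits m.unreducedPerm T
    fun K hK => (isCircle_iff.1 (hT K hK)).2
  -- On a deactivated circle `g` takes the step of `m`, landing on a vertex that `c` fixes;
  -- elsewhere `g` is trivial and the heads of `c` and `m` agree.
  have hperm : m.unreducedPerm = c.unreducedPerm * g := by
    ext v
    rw [Equiv.Perm.mul_apply, hg]
    split_ifs with hv
    · obtain ⟨K, hK, hv⟩ := hv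
      have hKm := isCircle_iff.1 (hT K hK)
      have hv' : m.unreducedPerm v ∈ K := by
        obtain ⟨x, rfl⟩ := hKm.2
        simp only [Finset.mem_filter, Finset.mem_univ, true_and] at hv ⊢
        exact Equiv.Perm.sameCycle_apply_right.2 hv
      exact (unreducedPerm_eq_self (mem_active.1 (hKm.1 hv')).1 (hTd hK hv')).symm
    · by_cases hu : v ∈ Set.range u
      · obtain ⟨i, rfl⟩ := hu
        simp
      · rw [m.unreducedPerm_apply ⟨v, hu⟩, c.unreducedPerm_apply ⟨v, hu⟩, hhead ⟨v, hu⟩ hv]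
  have hsign : Equiv.Perm.sign c.unreducedPerm =
      Equiv.Perm.sign m.unreducedPerm * ∏ K ∈ T, (-1) ^ (K.card + 1) := by
    rw [hperm, map_mul, ← hs, mul_assoc, Int.units_mul_self, mul_one]
  have hpart : ∀ K ∈ T, (∏ v : {v : V // v ∉ Set.range u},
      if (v : V) ∈ K then G.orient (m.tail v) * G.orient (m.head v) else 1) =
      (-1) ^ K.card * m.partSign K := by
    intro K hK
    have hKm := (hT K hK).subset_active
    have h1 : (∏ v : {v : V // v ∉ Set.range u}, if (v : V) ∈ K then (-1 : ℤˣ) else 1) =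
        (-1) ^ K.card := by
      rw [← Finset.prod_filter, Finset.prod_const]
      congr 1
      rw [← Finset.card_map (Function.Embedding.subtype _)]
      congr 1
      ext v
      simp only [Finset.mem_map, Finset.mem_filter, Finset.mem_univ, true_and,
        Function.Embedding.subtype_apply]
      exact ⟨fun ⟨a, ha, hav⟩ => hav ▸ ha, fun hv => ⟨⟨v, (mem_active.1 (hKm hv)).1⟩, hv, rfl⟩⟩
    rw [← h1, partSign, ← Finset.prod_mul_distrib]
    refine Finset.prod_congr rfl fun v _ => ?_
    split_ifs with hv
    · rw [pathSign, if_neg (coe_mem_active.1 (hKm hv))]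
      simp
    · simp
  have hprod : ∏ v, -(G.orient (c.tail v) * G.orient (c.head v)) =
      (∏ v, -(G.orient (m.tail v) * G.orient (m.head v))) *
        ∏ K ∈ T, (-1) ^ K.card * m.partSign K := by
    rw [← Finset.prod_congr rfl hpart, Finset.prod_comm, ← Finset.prod_mul_distrib]
    refine Finset.prod_congr rfl fun v _ => ?_
    by_cases hv : ∃ K ∈ T, (v : V) ∈ K
    · obtain ⟨K, hK, hv⟩ := hv
      rw [Finset.prod_eq_single K, if_pos hv, head_eq_of_not_mem_active (hTd hK hv),
        orient_mul_self, neg_mul, Int.units_mul_self]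
      · intro L hL hne
        exact if_neg fun hvL => hne ((hT L hL).eq_of_mem (hT K hK) hvL hv)
      · exact fun h => absurd hK h
    · rw [hhead v hv, h, Finset.prod_eq_one, mul_one]
      exact fun K hK => if_neg fun hvK => hv ⟨K, hK, hvK⟩
  have hcast : ∏ K ∈ T, (-(m.partSign K : ℤ)) = ((∏ K ∈ T, -m.partSign K : ℤˣ) : ℤ) := by
    push_cast; rfl
  have hcomb : ∏ K ∈ T, -m.partSign K =
      (∏ K ∈ T, (-1) ^ (K.card + 1)) * ∏ K ∈ T, (-1) ^ K.card * m.partSign K := by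
    rw [← Finset.prod_mul_distrib]
    refine Finset.prod_congr rfl fun K _ => ?_
    rw [pow_succ, ← mul_assoc, mul_right_comm ((-1 : ℤˣ) ^ K.card) (-1),
      Int.units_mul_self ((-1 : ℤˣ) ^ K.card), one_mul, neg_one_mul]
  rw [hcast, sgnD_eq, sgnD_eq, ← Units.val_mul, hsign, hprod, hcomb]
  congr 1
  exact mul_mul_mul_comm _ _ _ _

theorem IsTop.hasPositiveCircle {m c : ReducedContributor G u w} (hm : m.IsTop)
    (h : c.tail = m.tail) (hc : c.HasPositiveCircle) : m.HasPositiveCircle := by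
  obtain ⟨K, hK, hs⟩ := hc
  have := hK.of_subset_active h (hK.subset_active.trans (hm c h))
  exact ⟨K, this.1, this.2.1.trans hs⟩

/-! ### Sums over activation classes -/

variable [Fintype I]

theorem mem_activationClass {c c' : ReducedContributor G u w} :
    c' ∈ c.activationClass ↔ c.tail = c'.tail := by
  rw [activationClass, Finset.mem_filter]
  simp [TailEquiv]

/-- Expanding the product gives a sum over subsets of circles, and `deactivated` matches these
bijectively with the elements of the class. -/
theorem IsTop.sum_sgnD {m : ReducedContributor G u w} (hm : m.IsTop) :
    ∑ c ∈ m.activationClass, c.sgnD =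
      m.sgnD * ∏ K ∈ m.circleFinset, (1 + -(m.partSign K : ℤ)) := by
  rw [Finset.prod_one_add, Finset.mul_sum]
  refine Finset.sum_bij (fun c _ => m.deactivated c) ?_ ?_ ?_ ?_
  · intro c _
    exact Finset.mem_powerset.2 (Finset.filter_subset _ _)
  · intro c hc c' hc' heq
    rw [mem_activationClass] at hc hc'
    refine eq_of_active_eq (hc.symm.trans hc') ?_
    rw [hm.active_eq hc.symm, hm.active_eq hc'.symm, heq]
  · intro T hT
    rw [Finset.mem_powerset] at hT
    obtain ⟨c, hc, hca⟩ := m.exists_active_eq_sdiff hT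
    exact ⟨c, mem_activationClass.2 hc.symm, deactivated_eq hT hca⟩
  · intro c hc
    exact hm.sgnD_eq_mul_prod (mem_activationClass.1 hc).symm

theorem IsTop.sum_sgnD_of_hasPositiveCircle {m : ReducedContributor G u w} (hm : m.IsTop)
    (h : m.HasPositiveCircle) : ∑ c ∈ m.activationClass, c.sgnD = 0 := by
  obtain ⟨K, hK, hs⟩ := h
  rw [hm.sum_sgnD, Finset.prod_eq_zero (mem_circleFinset.2 hK) (by simp [hs]), mul_zero]

theorem IsTop.sum_sgnD_of_not_hasPositiveCircle {m : ReducedContributor G u w} (hm : m.IsTop)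
    (h : ¬ m.HasPositiveCircle) :
    ∑ c ∈ m.activationClass, c.sgnD = m.sgnD * 2 ^ m.numNegCircles := by
  have hneg : ∀ K, m.IsCircle K → m.partSign K = -1 := fun K hK =>
    (Int.units_eq_one_or _).resolve_left fun hs => h ⟨K, hK, hs⟩
  have hcard : m.numNegCircles = m.circleFinset.card := by
    rw [numNegCircles, circleFinset]
    congr 1
    exact Finset.filter_congr fun K _ => ⟨And.left, fun hK => ⟨hK, hneg K hK⟩⟩
  rw [hm.sum_sgnD, hcard, ← Finset.prod_const]
  congr 1
  refine Finset.prod_congr rfl fun K hK => ?_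
  rw [hneg K (mem_circleFinset.1 hK)]
  norm_num

/-- This links the order by circles to the order by active sets. A maximal `m` lies below a top
element `t`, so maximality gives `t ≤ m`, and the active set of `m` already contains that of `t`. -/
theorem maximal_iff_isTop {c m : ReducedContributor G u w} :
    Maximal (fun d => d ∈ c.activationClass) m ↔ c.tail = m.tail ∧ m.IsTop := by
  constructor
  · intro h
    have hcm := mem_activationClass.1 h.prop
    refine ⟨hcm, fun d hd => ?_⟩
    obtain ⟨t, ht, htop⟩ := exists_isTop m
    have hle : m ≤ t := ⟨ht.symm, htop.circles_subset ht.symm⟩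
    have hge := h.2 (mem_activationClass.2 (hcm.trans ht.symm)) hle
    exact (htop d (hd.trans ht.symm)).trans (active_subset_of_circles_subset ht hge.2)
  · rintro ⟨h, htop⟩
    refine ⟨mem_activationClass.2 h, fun d hd _ => ?_⟩
    have := (mem_activationClass.1 hd).symm.trans h
    exact ⟨this, htop.circles_subset this⟩

theorem activationClass_eq {c m : ReducedContributor G u w} (h : c.tail = m.tail) :
    c.activationClass = m.activationClass := by
  ext d
  rw [mem_activationClass, mem_activationClass, h]

theorem mem_activationClasses {A : Finset (ReducedContributor G u w)} :
    A ∈ G.activationClasses u w ↔ ∃ c : ReducedContributor G u w, c.activationClass = A := by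
  simp [activationClasses]

theorem mem_maximalElements {m : ReducedContributor G u w} :
    m ∈ G.maximalElements u w ↔ m.IsTop := by
  simp only [maximalElements, Finset.mem_filter, Finset.mem_univ, true_and]
  constructor
  · rintro ⟨A, hA, hm⟩
    obtain ⟨c, rfl⟩ := mem_activationClasses.1 hA
    exact (maximal_iff_isTop.1 hm).2
  · intro hm
    exact ⟨m.activationClass, mem_activationClasses.2 ⟨m, rfl⟩, maximal_iff_isTop.2 ⟨rfl, hm⟩⟩

theorem existsUnique_maximal {A : Finset (ReducedContributor G u w)}
    (hA : A ∈ G.activationClasses u w) :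
    ∃ m, Maximal (fun c => c ∈ A) m ∧ (∀ m', Maximal (fun c => c ∈ A) m' → m' = m) ∧
      (m ∈ G.negMaximalElements u w ↔ A ∈ G.negActivationClasses u w) := by
  have hA' := hA
  obtain ⟨c, rfl⟩ := mem_activationClasses.1 hA
  obtain ⟨m, hm, htop⟩ := exists_isTop c
  refine ⟨m, maximal_iff_isTop.2 ⟨hm.symm, htop⟩, fun m' h' => ?_, ?_⟩
  · obtain ⟨h1, h2⟩ := maximal_iff_isTop.1 h'
    exact h2.eq htop (h1.symm.trans hm.symm)
  · simp only [negMaximalElements, negActivationClasses, Finset.mem_filter, hA', true_and,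
      mem_maximalElements, htop]
    constructor
    · intro h d hd hpos
      exact h (htop.hasPositiveCircle ((mem_activationClass.1 hd).symm.trans hm.symm) hpos)
    · intro h
      exact h m (mem_activationClass.2 hm.symm)

theorem sum_sgnD_eq_zero {A : Finset (ReducedContributor G u w)}
    (hA : A ∈ G.activationClasses u w) (hpos : ∃ c ∈ A, c.HasPositiveCircle) :
    ∑ c ∈ A, c.sgnD = 0 := by
  obtain ⟨c, rfl⟩ := mem_activationClasses.1 hA
  obtain ⟨m, hm, htop⟩ := exists_isTop c
  obtain ⟨d, hd, hpos⟩ := hpos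
  rw [activationClass_eq hm.symm]
  exact htop.sum_sgnD_of_hasPositiveCircle
    (htop.hasPositiveCircle ((mem_activationClass.1 hd).symm.trans hm.symm) hpos)

theorem sum_sgnD_univ :
    ∑ c : ReducedContributor G u w, c.sgnD =
      ∑ m ∈ G.negMaximalElements u w, m.sgnD * 2 ^ m.numNegCircles := by
  choose top htail htop using fun c : ReducedContributor G u w => exists_isTop c
  -- Contributors are grouped by the top element of their class; the fibre over `m` is the whole
  -- class of `m`, by uniqueness of top elements.
  rw [← Finset.sum_fiberwise_of_maps_to (t := G.maximalElements u w) (g := top)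
    fun c _ => mem_maximalElements.2 (htop c), negMaximalElements, Finset.sum_filter]
  refine Finset.sum_congr rfl fun m hm => ?_
  rw [mem_maximalElements] at hm
  have : Finset.univ.filter (fun c => top c = m) = m.activationClass := by
    ext c
    simp only [Finset.mem_filter, Finset.mem_univ, true_and, mem_activationClass]
    constructor
    · rintro rfl
      exact htail c
    · intro h
      exact (htop c).eq hm ((htail c).trans h.symm)
  rw [this]
  split_ifs with h
  · exact hm.sum_sgnD_of_hasPositiveCircle h
  · exact hm.sum_sgnD_of_not_hasPositiveCircle h

end Fintype

end BidirectedGraph.ReducedContributor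

theorem theorem3p4 {V E I : Type*} [Fintype V] [Fintype I] (G : BidirectedGraph V E I)
    (u₁ u₂ w₁ w₂ : V) :
    -- each activation class has exactly one maximal element, which is free of positive circles
    -- if and only if the whole class is
    (∀ A ∈ G.activationClasses ![u₁, u₂] ![w₁, w₂],
      ∃ m, Maximal (fun c => c ∈ A) m ∧ (∀ m', Maximal (fun c => c ∈ A) m' → m' = m) ∧
        (m ∈ G.negMaximalElements ![u₁, u₂] ![w₁, w₂] ↔
          A ∈ G.negActivationClasses ![u₁, u₂] ![w₁, w₂])) ∧
    -- the evaluation of the transpedance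
    G.dTranspedance u₁ u₂ w₁ w₂ =
      ∑ m ∈ G.negMaximalElements ![u₁, u₂] ![w₁, w₂], m.sgnD * 2 ^ m.numNegCircles ∧
    -- each class that contains a positive circle cancels
    (∀ A ∈ G.activationClasses ![u₁, u₂] ![w₁, w₂], (∃ c ∈ A, c.HasPositiveCircle) →
      ∑ c ∈ A, c.sgnD = 0) := by
  exact ⟨fun _ hA => BidirectedGraph.ReducedContributor.existsUnique_maximal hA,
    BidirectedGraph.ReducedContributor.sum_sgnD_univ,
    fun _ hA h => BidirectedGraph.ReducedContributor.sum_sgnD_eq_zero hA h⟩
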